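/- Fix integers $k,\ell\ge 1$ and $\varepsilon>0$. Each of $n$ users holds one independent sample $X_t$ from an unknown distribution $p$ on $[2k]=\{1,\dots,2k\}$. A public random variable $U$, independent of the samples and with values in an arbitrary measurable space, is available to all users and to the server. In a sequentially interactive protocol with $\ell$-bit messages, users $t=1,\dots,n$ act in turn: user $t$ selects, as a (measurable) function of $U$ and of the previous messages $Y_1,\dots,Y_{t-1}$, an arbitrary channel (randomized map) $W_t\colon[2k]\to\{0,1\}^\ell$, and sends a message $Y_t$ that equals $y$ with probability $W_t(y\mid X_t)$. Such a protocol together with a (measurable) map $\hat p$, which sends $(Y_1,\dots,Y_n,U)$ to a distribution on $[2k]$, is an $(n,\varepsilon)$-estimator if for every distribution $p$ on $[2k]$ $$\Pr\bigl[d_{\mathrm{TV}}(\hat p(Y_1,\dots,Y_n,U),p)>\varepsilon\bigr]\le \tfrac1{100},$$ where $d_{\mathrm{TV}}(p,q)=\sup_{S\subseteq[2k]}(p(S)-q(S))$. The sample complexity of interactive $(2k,\varepsilon)$-distribution learning under $\ell$-bit communication constraints is the least $n$ for which an $(n,\varepsilon)$-estimator exists. Then there is an absolute constant $c>0$ such that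 for all integers $k,\ell$ with $1\le\ell\le\log_2 k$ and all $0<\varepsilon\le 1/4$, this sample complexity is at least $$c\,\frac{k^2}{\varepsilon^2\,2^\ell}.$$ -/

import Mathlib

open MeasureTheory
open scoped ENNReal

universe u

namespace DistLearn

noncomputable section

/-- Probability distributions on a finite set `A`, identified with their mass functions. -/
abbrev ProbDist (A : Type*) [Fintype A] : Type _ := stdSimplex ℝ A

/-- Total variation distance `sup_{S ⊆ A} (p(S) - q(S))`. -/
def tv {A : Type*} [Fintype A] (p q : ProbDist A) : ℝ :=
  ⨆ S : Finset A, (∑ x ∈ S, p.1 x - ∑ x ∈ S, q.1 x)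

/-- A channel from `[m]` to the finite message alphabet `Y`: `(W x).1 y` is `W(y ∣ x)`. -/
abbrev Channel (m : ℕ) (Y : Type*) [Fintype Y] : Type _ := Fin m → ProbDist Y

/-- The communication constraint: all channels from `[m]` to the `ℓ`-bit strings. -/
def commChannels (m ℓ : ℕ) : Set (Channel m (Fin ℓ → Bool)) := Set.univ

/-- The messages `Y_1, …, Y_{t-1}` sent before user `t`. -/
def past {n : ℕ} {Y : Type*} (y : Fin n → Y) (t : Fin n) : Fin t.1 → Y :=
  fun s => y ⟨s.1, s.2.trans t.2⟩

/-- A sequentially interactive protocol for `n` users with public coins in `Ω`, using `𝒲`: user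
`t` chooses a channel in `𝒲` as a (measurable) function of the previous messages and the coins. -/
structure Protocol {m : ℕ} {Y : Type*} [Fintype Y] (𝒲 : Set (Channel m Y)) (n : ℕ)
    (Ω : Type u) [MeasurableSpace Ω] where
  /-- the channel chosen by user `t` -/
  channel : (t : Fin n) → (Fin t.1 → Y) → Ω → Channel m Y
  channel_mem : ∀ t h ω, channel t h ω ∈ 𝒲
  measurable_channel : ∀ t h, Measurable (channel t h)

variable {m : ℕ} {Y : Type*} [Fintype Y] {𝒲 : Set (Channel m Y)} {n : ℕ}
  {Ω : Type u} [MeasurableSpace Ω]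

/-- The probability that the users observe the samples `x` and send the messages `y`, when the
samples are i.i.d. from `p` and the public coins are `ω`. -/
def Protocol.jointProb (P : Protocol 𝒲 n Ω) (p : ProbDist (Fin m)) (ω : Ω)
    (x : Fin n → Fin m) (y : Fin n → Y) : ℝ :=
  ∏ t, p.1 (x t) * (P.channel t (past y t) ω (x t)).1 (y t)

/-- The probability of the messages `y` when the samples are i.i.d. from `p` and the public
coins are `ω`. -/
def Protocol.transcriptProb (P : Protocol 𝒲 n Ω) (p : ProbDist (Fin m)) (ω : Ω)
    (y : Fin n → Y) : ℝ :=
  ∑ x : Fin n → Fin m, P.jointProb p ω x y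

open Classical in
/-- The probability, over the coins (with law `μ`), the samples and the messages, that the
estimate `est y ω` has total variation distance more than `ε` from the input distribution `p`. -/
def Protocol.failureProb (P : Protocol 𝒲 n Ω) (μ : Measure Ω)
    (est : (Fin n → Y) → Ω → ProbDist (Fin m)) (ε : ℝ) (p : ProbDist (Fin m)) : ℝ≥0∞ :=
  ∫⁻ ω, ENNReal.ofReal
    (∑ y : Fin n → Y, if ε < tv (est y ω) p then P.transcriptProb p ω y else 0) ∂μ

/-- There is an interactive `(n, ε)`-estimator for distributions over `[m]` using `𝒲`: public
coins, a protocol and an estimator that fails with probability at most `1/100` for every `p`. -/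
def HasEstimator (𝒲 : Set (Channel m Y)) (n : ℕ) (ε : ℝ) : Prop :=
  ∃ (Ω : Type u) (_ : MeasurableSpace Ω) (μ : Measure Ω) (_ : IsProbabilityMeasure μ)
    (P : Protocol 𝒲 n Ω) (est : (Fin n → Y) → Ω → ProbDist (Fin m)),
    (∀ y, Measurable (est y)) ∧ ∀ p : ProbDist (Fin m), P.failureProb μ est ε p ≤ 1 / 100

/-- The sample complexity of interactive `(m, ε)`-distribution learning using `𝒲`: the least `n`
for which there is an interactive `(n, ε)`-estimator (`⊤` if there is none). -/
def sampleComplexity (𝒲 : Set (Channel m Y)) (ε : ℝ) : ℕ∞ :=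
  ⨅ (n : ℕ) (_ : HasEstimator.{u} 𝒲 n ε), (n : ℕ∞)

end

end DistLearn

/-! The argument is Assouad's method on a cube of hard instances. Split `[2k]` into `k` pairs and,
for signs `z`, shift the uniform masses in pair `i` by `±γ/(2k)` according to `z i`, with `γ = 3ε`.
An estimate within `ε` in total variation determines the scaled signs `γ/k * sgn (z i)` up to `ℓ₁`
error `2ε`, whereas guessing costs about `γ` (`assouad`). So the laws of the transcript under `z`
and under `flipBit i z` must be well separated for many `i`.

One message separates them only a little: summed over all `i`, its divergence is `O(γ² |Y| / k)`
(`sum_finKL_msgLaw_le`). The chain rule makes this additive over the `n` users even when channels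
are adaptive (`sum_finKL_seqProb_le`). The total must be of order `k`, whence `n ≳ k² / (ε² |Y|)`
with `|Y| = 2^ℓ`. Public coins are removed by fixing one value that is good on average over the
cube. -/

namespace DistLearn

noncomputable section

/-! ### Divergence, total variation and chi-square on finite sets -/

section FiniteDivergence

variable {A : Type*} [Fintype A]

/-- The Kullback–Leibler divergence of mass functions on a finite set. -/
def finKL (P Q : A → ℝ) : ℝ := ∑ a, P a * Real.log (P a / Q a)

theorem two_mul_sub_sqrt_mul_sqrt_le {a b : ℝ} (ha : 0 ≤ a) (hb : 0 ≤ b) (hab : b = 0 → a = 0) :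
    2 * (a - √a * √b) ≤ a * Real.log (a / b) := by
  rcases ha.eq_or_lt with rfl | ha'
  · simp
  have hb' : 0 < b := hb.lt_of_ne fun h => ha'.ne' (hab h.symm)
  have hsa := Real.sqrt_pos.2 ha'
  have hsb := Real.sqrt_pos.2 hb'
  have h1 : Real.log (a / b) = -(2 * Real.log (√b / √a)) := by
    rw [Real.log_div hsb.ne' hsa.ne', Real.log_div ha'.ne' hb'.ne', Real.log_sqrt ha, Real.log_sqrt hb]
    ring
  have h2 := Real.log_le_sub_one_of_pos (div_pos hsb hsa)
  have h3 : a * (√b / √a) = √a * √b := by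
    rw [mul_div_assoc', div_eq_iff hsa.ne']
    nlinarith [Real.mul_self_sqrt ha]
  rw [h1]
  nlinarith [mul_le_mul_of_nonneg_left h2 ha]

/-- A Pinsker-type bound through the affinity `β = ∑ √P √Q`: Cauchy–Schwarz bounds the squared total
variation by `1 - β²`, which is at most `2(1 - β)`, and `log x ≤ x - 1` bounds that by the
divergence. -/
theorem sq_sum_abs_sub_le_finKL {P Q : A → ℝ} (hP : ∀ a, 0 ≤ P a) (hQ : ∀ a, 0 ≤ Q a)
    (hP1 : ∑ a, P a = 1) (hQ1 : ∑ a, Q a = 1) (hPQ : ∀ a, Q a = 0 → P a = 0) :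
    ((∑ a, |P a - Q a|) / 2) ^ 2 ≤ finKL P Q := by
  have hkl : 2 * (1 - ∑ a, √(P a) * √(Q a)) ≤ finKL P Q := by
    rw [← hP1, ← Finset.sum_sub_distrib, Finset.mul_sum]
    exact Finset.sum_le_sum fun a _ => two_mul_sub_sqrt_mul_sqrt_le (hP a) (hQ a) (hPQ a)
  have hsub : ∑ a, |√(P a) - √(Q a)| ^ 2 = 2 - 2 * ∑ a, √(P a) * √(Q a) := by
    have : ∀ a, |√(P a) - √(Q a)| ^ 2 = P a + Q a - 2 * (√(P a) * √(Q a)) := fun a => by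
      rw [sq_abs]; nlinarith [Real.mul_self_sqrt (hP a), Real.mul_self_sqrt (hQ a)]
    simp only [this, Finset.sum_sub_distrib, Finset.sum_add_distrib, hP1, hQ1, ← Finset.mul_sum]
    ring
  have hadd : ∑ a, (√(P a) + √(Q a)) ^ 2 = 2 + 2 * ∑ a, √(P a) * √(Q a) := by
    have : ∀ a, (√(P a) + √(Q a)) ^ 2 = P a + Q a + 2 * (√(P a) * √(Q a)) := fun a => by
      nlinarith [Real.mul_self_sqrt (hP a), Real.mul_self_sqrt (hQ a)]
    simp only [this, Finset.sum_add_distrib, hP1, hQ1, ← Finset.mul_sum]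
    ring
  have hcs := Finset.sum_mul_sq_le_sq_mul_sq Finset.univ
    (fun a => |√(P a) - √(Q a)|) (fun a => √(P a) + √(Q a))
  have habs : ∀ a, |√(P a) - √(Q a)| * (√(P a) + √(Q a)) = |P a - Q a| := fun a => by
    rw [← abs_of_nonneg (add_nonneg (Real.sqrt_nonneg (P a)) (Real.sqrt_nonneg (Q a))), ← abs_mul]
    congr 1
    nlinarith [Real.mul_self_sqrt (hP a), Real.mul_self_sqrt (hQ a)]
  simp only [habs, hsub, hadd] at hcs
  nlinarith [sq_nonneg (1 - ∑ a, √(P a) * √(Q a))]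

theorem finKL_le_chiSq {P Q : A → ℝ} (hP : ∀ a, 0 ≤ P a) (hQ : ∀ a, 0 ≤ Q a)
    (hP1 : ∑ a, P a = 1) (hQ1 : ∑ a, Q a = 1) (hPQ : ∀ a, Q a = 0 → P a = 0) :
    finKL P Q ≤ ∑ a, (P a - Q a) ^ 2 / Q a := by
  -- The extra term `P a - Q a` sums to zero; it makes the comparison hold term by term.
  have h : ∀ a, P a * Real.log (P a / Q a) ≤ (P a - Q a) ^ 2 / Q a + (P a - Q a) := fun a => by
    rcases (hP a).eq_or_lt with h0 | h0
    · rw [← h0]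
      rcases (hQ a).eq_or_lt with h1 | h1
      · simp [← h1]
      · have : (0 - Q a) ^ 2 / Q a = Q a := by field_simp; ring
        rw [this, zero_mul]
        linarith
    · have h1 : 0 < Q a := (hQ a).lt_of_ne fun h => h0.ne' (hPQ a h.symm)
      have h2 := mul_le_mul_of_nonneg_left (Real.log_le_sub_one_of_pos (div_pos h0 h1)) h0.le
      refine h2.trans_eq ?_
      field_simp
      ring
  refine (Finset.sum_le_sum fun a _ => h a).trans_eq ?_
  rw [Finset.sum_add_distrib, Finset.sum_sub_distrib, hP1, hQ1]
  ring

end FiniteDivergence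

/-! ### Chain rule for adaptively generated messages -/

section Sequential

variable {Y : Type*}

/-- The probability of the messages `y` when message `t` has conditional law `q t` given the
earlier ones. -/
def seqProb {n : ℕ} (q : (t : Fin n) → (Fin t.1 → Y) → Y → ℝ) (y : Fin n → Y) : ℝ :=
  ∏ t, q t (past y t) (y t)

theorem seqProb_snoc {n : ℕ} (q : (t : Fin (n + 1)) → (Fin t.1 → Y) → Y → ℝ) (y : Fin n → Y)
    (a : Y) : seqProb q (Fin.snoc (α := fun _ => Y) y a) =
      seqProb (fun t => q t.castSucc) y * q (Fin.last n) y a := by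
  unfold seqProb
  rw [Fin.prod_univ_castSucc]
  congr 1
  · refine Finset.prod_congr rfl fun t _ => ?_
    rw [Fin.snoc_castSucc]
    refine congrArg (fun h => q t.castSucc h (y t)) (funext fun s => ?_)
    exact Fin.snoc_castSucc (α := fun _ => Y) (x := a) (p := y) ⟨s.1, s.2.trans t.2⟩
  · rw [Fin.snoc_last]
    refine congrArg (fun h => q (Fin.last n) h a) (funext fun s => ?_)
    exact Fin.snoc_castSucc (α := fun _ => Y) (x := a) (p := y) s

theorem seqProb_nonneg {n : ℕ} {q : (t : Fin n) → (Fin t.1 → Y) → Y → ℝ}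
    (hq : ∀ t h a, 0 ≤ q t h a) (y : Fin n → Y) : 0 ≤ seqProb q y :=
  Finset.prod_nonneg fun t _ => hq t _ _

theorem seqProb_eq_zero {n : ℕ} {q q' : (t : Fin n) → (Fin t.1 → Y) → Y → ℝ}
    (hqq : ∀ t h a, q' t h a = 0 → q t h a = 0) (y : Fin n → Y) (hy : seqProb q' y = 0) :
    seqProb q y = 0 := by
  obtain ⟨t, ht, h0⟩ := Finset.prod_eq_zero_iff.1 hy
  exact Finset.prod_eq_zero ht (hqq _ _ _ h0)

variable [Fintype Y]

theorem sum_snoc {n : ℕ} (f : (Fin (n + 1) → Y) → ℝ) :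
    ∑ y, f y = ∑ y : Fin n → Y, ∑ a, f (Fin.snoc (α := fun _ => Y) y a) := by
  rw [← (Fin.snocEquiv fun _ : Fin (n + 1) => Y).sum_comp, Fintype.sum_prod_type_right]
  rfl

theorem sum_seqProb {n : ℕ} {q : (t : Fin n) → (Fin t.1 → Y) → Y → ℝ}
    (hq : ∀ t h, ∑ a, q t h a = 1) : ∑ y, seqProb q y = 1 := by
  induction n with
  | zero => simp [seqProb]
  | succ n ih =>
    rw [sum_snoc]
    simp only [seqProb_snoc, ← Finset.mul_sum]
    rw [← ih (q := fun t => q t.castSucc) fun t h => hq t.castSucc h]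
    exact Finset.sum_congr rfl fun y _ => by rw [hq (Fin.last n) y, mul_one]

theorem finKL_seqProb_succ {n : ℕ} {q q' : (t : Fin (n + 1)) → (Fin t.1 → Y) → Y → ℝ}
    (hq : ∀ t h, ∑ a, q t h a = 1) (hqq : ∀ t h a, q' t h a = 0 → q t h a = 0) :
    finKL (seqProb q) (seqProb q') =
      finKL (seqProb fun t => q t.castSucc) (seqProb fun t => q' t.castSucc) +
        ∑ y, seqProb (fun t => q t.castSucc) y *
          finKL (q (Fin.last n) y) (q' (Fin.last n) y) := by
  unfold finKL
  rw [sum_snoc, ← Finset.sum_add_distrib]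
  refine Finset.sum_congr rfl fun y _ => ?_
  set S := seqProb (fun t => q t.castSucc) y with hS
  set S' := seqProb (fun t => q' t.castSucc) y with hS'
  have hSS : S' = 0 → S = 0 := seqProb_eq_zero (fun t h a => hqq t.castSucc h a) y
  have h : ∀ a, seqProb q (Fin.snoc (α := fun _ => Y) y a) *
      Real.log (seqProb q (Fin.snoc (α := fun _ => Y) y a) /
        seqProb q' (Fin.snoc (α := fun _ => Y) y a)) =
      q (Fin.last n) y a * (S * Real.log (S / S')) +
        S * (q (Fin.last n) y a *
          Real.log (q (Fin.last n) y a / q' (Fin.last n) y a)) := fun a => by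
    rw [seqProb_snoc, seqProb_snoc, ← hS, ← hS']
    by_cases h0 : S = 0
    · simp [h0]
    by_cases h1 : q (Fin.last n) y a = 0
    · simp [h1]
    have h0' : S' ≠ 0 := fun h => h0 (hSS h)
    have h1' : q' (Fin.last n) y a ≠ 0 := fun h => h1 (hqq _ _ _ h)
    rw [mul_div_mul_comm, Real.log_mul (div_ne_zero h0 h0') (div_ne_zero h1 h1')]
    ring
  simp only [h, Finset.sum_add_distrib, ← Finset.sum_mul, ← Finset.mul_sum]
  rw [hq (Fin.last n) y, one_mul]

/-- The chain rule averages the conditional divergences under `q` alone, a law that does not depend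
on `i`. Hence the sum over `i` moves inside the average, and a bound uniform over histories
suffices. -/
theorem sum_finKL_seqProb_le {ι : Type*} [Fintype ι] {n : ℕ}
    {q : (t : Fin n) → (Fin t.1 → Y) → Y → ℝ} {q' : ι → (t : Fin n) → (Fin t.1 → Y) → Y → ℝ}
    (hq0 : ∀ t h a, 0 ≤ q t h a) (hq : ∀ t h, ∑ a, q t h a = 1)
    (hqq : ∀ i t h a, q' i t h a = 0 → q t h a = 0) {B : ℝ}
    (hB : ∀ t h, ∑ i, finKL (q t h) (q' i t h) ≤ B) :
    ∑ i, finKL (seqProb q) (seqProb (q' i)) ≤ n * B := by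
  induction n with
  | zero => simp [finKL, seqProb]
  | succ n ih =>
    have h1 := ih (q := fun t => q t.castSucc) (q' := fun i t => q' i t.castSucc)
      (fun t => hq0 t.castSucc) (fun t => hq t.castSucc) (fun i t => hqq i t.castSucc)
      (fun t => hB t.castSucc)
    have h2 : ∑ i, ∑ y, seqProb (fun t => q t.castSucc) y *
        finKL (q (Fin.last n) y) (q' i (Fin.last n) y) ≤ B := by
      rw [Finset.sum_comm]
      simp only [← Finset.mul_sum]
      calc _ ≤ ∑ y, seqProb (fun t => q t.castSucc) y * B :=
            Finset.sum_le_sum fun y _ => mul_le_mul_of_nonneg_left (hB (Fin.last n) y)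
              (seqProb_nonneg (fun t => hq0 t.castSucc) y)
        _ = B := by
            rw [← Finset.sum_mul, sum_seqProb fun t => hq t.castSucc, one_mul]
    have h3 : ∀ i, _ := fun i => finKL_seqProb_succ (q := q) (q' := q' i) hq (hqq i)
    simp only [h3, Finset.sum_add_distrib]
    push_cast
    linarith

end Sequential

/-! ### Total variation and the `ℓ₁` distance -/

section TotalVariation

variable {A : Type*} [Fintype A]

theorem sub_le_tv (p q : ProbDist A) (S : Finset A) :
    ∑ x ∈ S, p.1 x - ∑ x ∈ S, q.1 x ≤ tv p q :=
  le_ciSup (f := fun S : Finset A => ∑ x ∈ S, p.1 x - ∑ x ∈ S, q.1 x)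
    (Set.finite_range _).bddAbove S

theorem half_sum_abs_le_tv (p q : ProbDist A) : (∑ x, |p.1 x - q.1 x|) / 2 ≤ tv p q := by
  classical
  refine le_trans (le_of_eq ?_) (sub_le_tv p q (Finset.univ.filter fun x => 0 ≤ p.1 x - q.1 x))
  have h0 : ∑ x, (p.1 x - q.1 x) = 0 := by
    rw [Finset.sum_sub_distrib, p.2.2, q.2.2, sub_self]
  have h1 : ∀ x, |p.1 x - q.1 x| =
      2 * (if 0 ≤ p.1 x - q.1 x then p.1 x - q.1 x else 0) - (p.1 x - q.1 x) := fun x => by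
    split_ifs with h
    · rw [abs_of_nonneg h]; ring
    · rw [abs_of_neg (not_le.1 h)]; ring
  simp only [h1]
  rw [Finset.sum_sub_distrib, h0, ← Finset.mul_sum, ← Finset.sum_sub_distrib, Finset.sum_filter]
  ring

theorem measurable_tv {Ω : Type*} [MeasurableSpace Ω] {f : Ω → ProbDist A} (hf : Measurable f)
    (q : ProbDist A) : Measurable fun ω => tv (f ω) q := by
  refine Measurable.iSup fun S => Measurable.sub_const ?_ _
  exact Finset.measurable_fun_sum _ fun x _ => (measurable_pi_apply x).comp hf.subtype_val

end TotalVariation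

/-! ### Transcript laws and removal of the public coins -/

section MessageLaw

variable {m : ℕ} {Y : Type*} [Fintype Y]

/-- The law of the message sent through the channel `W` when the sample has law `p`. -/
def msgLaw (W : Channel m Y) (p : ProbDist (Fin m)) (a : Y) : ℝ := ∑ x, p.1 x * (W x).1 a

theorem msgLaw_nonneg (W : Channel m Y) (p : ProbDist (Fin m)) (a : Y) : 0 ≤ msgLaw W p a :=
  Finset.sum_nonneg fun x _ => mul_nonneg (p.2.1 x) ((W x).2.1 a)

theorem sum_msgLaw (W : Channel m Y) (p : ProbDist (Fin m)) : ∑ a, msgLaw W p a = 1 := by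
  unfold msgLaw
  rw [Finset.sum_comm]
  simp only [← Finset.mul_sum, (W _).2.2, mul_one, p.2.2]

variable {𝒲 : Set (Channel m Y)} {n : ℕ} {Ω : Type u} [MeasurableSpace Ω]

theorem Protocol.transcriptProb_eq_seqProb (P : Protocol 𝒲 n Ω) (p : ProbDist (Fin m)) (ω : Ω)
    (y : Fin n → Y) :
    P.transcriptProb p ω y = seqProb (fun t h => msgLaw (P.channel t h ω) p) y := by
  unfold transcriptProb jointProb seqProb msgLaw
  rw [Finset.prod_univ_sum, Fintype.piFinset_univ]

theorem Protocol.measurable_transcriptProb (P : Protocol 𝒲 n Ω) (p : ProbDist (Fin m))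
    (y : Fin n → Y) : Measurable fun ω => P.transcriptProb p ω y := by
  unfold transcriptProb jointProb
  refine Finset.measurable_fun_sum _ fun x _ => Finset.measurable_fun_prod _ fun t _ =>
    Measurable.const_mul ?_ _
  exact (measurable_pi_apply (y t)).comp
    ((measurable_pi_apply (x t)).comp (P.measurable_channel t (past y t))).subtype_val

open Classical in
/-- The failure probability when the public coins are `ω`. -/
def Protocol.failureAt (P : Protocol 𝒲 n Ω) (est : (Fin n → Y) → Ω → ProbDist (Fin m)) (ε : ℝ)
    (p : ProbDist (Fin m)) (ω : Ω) : ℝ :=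
  ∑ y : Fin n → Y, if ε < tv (est y ω) p then P.transcriptProb p ω y else 0

theorem Protocol.transcriptProb_nonneg (P : Protocol 𝒲 n Ω) (p : ProbDist (Fin m)) (ω : Ω)
    (y : Fin n → Y) : 0 ≤ P.transcriptProb p ω y := by
  rw [P.transcriptProb_eq_seqProb]
  exact seqProb_nonneg (fun t h a => msgLaw_nonneg _ _ _) _

theorem Protocol.sum_transcriptProb (P : Protocol 𝒲 n Ω) (p : ProbDist (Fin m)) (ω : Ω) :
    ∑ y, P.transcriptProb p ω y = 1 := by
  simp only [P.transcriptProb_eq_seqProb]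
  exact sum_seqProb fun t h => sum_msgLaw _ _

theorem Protocol.failureAt_nonneg (P : Protocol 𝒲 n Ω) (est : (Fin n → Y) → Ω → ProbDist (Fin m))
    (ε : ℝ) (p : ProbDist (Fin m)) (ω : Ω) : 0 ≤ P.failureAt est ε p ω := by
  refine Finset.sum_nonneg fun y _ => ?_
  split_ifs
  exacts [P.transcriptProb_nonneg p ω y, le_rfl]

theorem Protocol.measurable_failureAt (P : Protocol 𝒲 n Ω)
    {est : (Fin n → Y) → Ω → ProbDist (Fin m)} (hest : ∀ y, Measurable (est y)) (ε : ℝ)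
    (p : ProbDist (Fin m)) : Measurable (P.failureAt est ε p) := by
  unfold failureAt
  exact Finset.measurable_fun_sum _ fun y _ => Measurable.ite
    (measurableSet_lt measurable_const (measurable_tv (hest y) p))
    (P.measurable_transcriptProb p y) measurable_const

/-- For every finite family of input distributions, some value of the public coins is at least
as good on average as the random coins. -/
theorem Protocol.exists_sum_failureAt_le (P : Protocol 𝒲 n Ω) (μ : Measure Ω)
    [IsProbabilityMeasure μ] {est : (Fin n → Y) → Ω → ProbDist (Fin m)}
    (hest : ∀ y, Measurable (est y)) {ε : ℝ} {ι : Type*} [Fintype ι] (p : ι → ProbDist (Fin m))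
    (hp : ∀ i, P.failureProb μ est ε (p i) ≤ 1 / 100) :
    ∃ ω, ∑ i, P.failureAt est ε (p i) ω ≤ Fintype.card ι * (1 / 100) := by
  have hmeas : ∀ i, Measurable fun ω => ENNReal.ofReal (P.failureAt est ε (p i) ω) := fun i =>
    (P.measurable_failureAt hest ε (p i)).ennreal_ofReal
  obtain ⟨ω, hω⟩ := exists_le_lintegral (μ := μ)
    (Finset.measurable_fun_sum Finset.univ fun i _ => hmeas i).aemeasurable
  refine ⟨ω, ?_⟩
  rw [lintegral_finsetSum _ fun i _ => hmeas i] at hω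
  have h := hω.trans (Finset.sum_le_sum fun i _ => hp i)
  rw [← ENNReal.ofReal_sum_of_nonneg fun i _ => P.failureAt_nonneg est ε (p i) ω] at h
  rw [Finset.sum_const, Finset.card_univ, nsmul_eq_mul] at h
  have h2 : (Fintype.card ι : ℝ≥0∞) * (1 / 100) =
      ENNReal.ofReal (Fintype.card ι * (1 / 100)) := by
    rw [ENNReal.ofReal_mul (by positivity), ENNReal.ofReal_natCast,
      ENNReal.ofReal_div_of_pos (by norm_num)]
    simp
  rw [h2] at h
  exact (ENNReal.ofReal_le_ofReal_iff (by positivity)).1 h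

end MessageLaw

/-! ### Assouad's lemma on the cube -/

section Cube

/-- The sign of a bit. -/
def sgn (b : Bool) : ℝ := if b then 1 else -1

@[simp] theorem sgn_true : sgn true = 1 := rfl

@[simp] theorem sgn_false : sgn false = -1 := rfl

theorem sgn_not (b : Bool) : sgn (!b) = -sgn b := by cases b <;> simp

theorem sgn_sq (b : Bool) : sgn b ^ 2 = 1 := by cases b <;> simp

theorem abs_sgn (b : Bool) : |sgn b| = 1 := by cases b <;> simp

variable {k : ℕ}

/-- The point of the cube obtained from `z` by flipping its `i`th bit. -/
def flipBit (i : Fin k) (z : Fin k → Bool) : Fin k → Bool := Function.update z i (!z i)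

@[simp] theorem flipBit_same (i : Fin k) (z : Fin k → Bool) : flipBit i z i = !z i := by
  simp [flipBit]

theorem flipBit_of_ne {i j : Fin k} (h : j ≠ i) (z : Fin k → Bool) : flipBit i z j = z j := by
  simp [flipBit, h]

theorem flipBit_involutive (i : Fin k) : Function.Involutive (flipBit i) := fun z => by
  simp [flipBit]

theorem sum_flipBit (i : Fin k) (f : (Fin k → Bool) → ℝ) : ∑ z, f (flipBit i z) = ∑ z, f z :=
  Equiv.sum_comp (flipBit_involutive i).toPerm f

/-- Assouad's lemma for estimating the vertices of a cube with half edge length `g` in `ℓ₁`. -/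
theorem assouad {A : Type*} [Fintype A] (P : (Fin k → Bool) → A → ℝ) (hP : ∀ z a, 0 ≤ P z a)
    (hP1 : ∀ z, ∑ a, P z a = 1) (c : A → Fin k → ℝ) {g : ℝ} (hg : 0 ≤ g) :
    g * ∑ z, ∑ i, (1 - (∑ a, |P z a - P (flipBit i z) a|) / 2) ≤
      ∑ z, ∑ a, P z a * ∑ i, |c a i - g * sgn (z i)| := by
  have hi : ∀ i, g * ∑ z, (1 - (∑ a, |P z a - P (flipBit i z) a|) / 2) ≤
      ∑ z, ∑ a, P z a * |c a i - g * sgn (z i)| := fun i => by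
    have hflip := sum_flipBit i fun z => ∑ a, P z a * |c a i - g * sgn (z i)|
    simp only [flipBit_same, sgn_not] at hflip
    have hz : ∀ z, 2 * (g * (1 - (∑ a, |P z a - P (flipBit i z) a|) / 2)) ≤
        ∑ a, P z a * |c a i - g * sgn (z i)| +
          ∑ a, P (flipBit i z) a * |c a i - g * -sgn (z i)| := fun z => by
      have h1 : 2 * (g * (1 - (∑ a, |P z a - P (flipBit i z) a|) / 2)) =
          ∑ a, g * (P z a + P (flipBit i z) a - |P z a - P (flipBit i z) a|) := by
        rw [← Finset.mul_sum, Finset.sum_sub_distrib, Finset.sum_add_distrib, hP1, hP1]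
        ring
      rw [h1, ← Finset.sum_add_distrib]
      refine Finset.sum_le_sum fun a _ => ?_
      have h2 : 2 * g ≤ |c a i - g * sgn (z i)| + |c a i - g * -sgn (z i)| := by
        have := abs_sub (c a i - g * sgn (z i)) (c a i - g * -sgn (z i))
        have h3 : (c a i - g * sgn (z i)) - (c a i - g * -sgn (z i)) = -(2 * g) * sgn (z i) := by
          ring
        rw [h3, abs_mul, abs_sgn, abs_neg, abs_of_nonneg (by positivity : 0 ≤ 2 * g)] at this
        linarith
      have ha := hP z a
      have hb := hP (flipBit i z) a
      have hu := abs_nonneg (c a i - g * sgn (z i))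
      have hv := abs_nonneg (c a i - g * -sgn (z i))
      -- The two errors, weighted by `P z a` and `P (flipBit i z) a`, are at least the smaller
      -- weight times their sum, and twice that minimum is `P + P' - |P - P'|`.
      rcases abs_cases (P z a - P (flipBit i z) a) with ⟨h, _⟩ | ⟨h, _⟩ <;> rw [h] <;> nlinarith
    have hsum := Finset.sum_le_sum fun z (_ : z ∈ Finset.univ) => hz z
    rw [Finset.sum_add_distrib, hflip, ← Finset.mul_sum, ← Finset.mul_sum] at hsum
    linarith
  calc g * ∑ z, ∑ i, (1 - (∑ a, |P z a - P (flipBit i z) a|) / 2)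
      = ∑ i, g * ∑ z, (1 - (∑ a, |P z a - P (flipBit i z) a|) / 2) := by
        rw [Finset.sum_comm, Finset.mul_sum]
    _ ≤ ∑ i, ∑ z, ∑ a, P z a * |c a i - g * sgn (z i)| := Finset.sum_le_sum fun i _ => hi i
    _ = ∑ z, ∑ a, P z a * ∑ i, |c a i - g * sgn (z i)| := by
        rw [Finset.sum_comm]
        refine Finset.sum_congr rfl fun z _ => ?_
        rw [Finset.sum_comm]
        simp only [Finset.mul_sum]

end Cube

/-! ### The perturbed distributions and the information in one message -/

section Perturbation

variable {k : ℕ}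

/-- The elements of `[2k]`, arranged in `k` pairs. -/
def pairing (k : ℕ) : Bool × Fin k ≃ Fin (2 * k) :=
  (finTwoEquiv.symm.prodCongr (Equiv.refl (Fin k))).trans finProdFinEquiv

theorem sum_pairing (f : Fin (2 * k) → ℝ) :
    ∑ x, f x = ∑ i, (f (pairing k (true, i)) + f (pairing k (false, i))) := by
  rw [← (pairing k).sum_comp, Fintype.sum_prod_type_right]
  simp

/-- The perturbation of the uniform mass function on `[2k]` by the signs `z`. -/
def perturbedMass (γ : ℝ) (z : Fin k → Bool) (x : Fin (2 * k)) : ℝ :=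
  (1 + γ * (sgn ((pairing k).symm x).1 * sgn (z ((pairing k).symm x).2))) / (2 * k)

@[simp] theorem perturbedMass_pairing (γ : ℝ) (z : Fin k → Bool) (b : Bool) (i : Fin k) :
    perturbedMass γ z (pairing k (b, i)) = (1 + γ * (sgn b * sgn (z i))) / (2 * k) := by
  simp [perturbedMass]

theorem le_perturbedMass {γ : ℝ} (h0 : 0 ≤ γ) (z : Fin k → Bool) (x : Fin (2 * k)) :
    (1 - γ) / (2 * k) ≤ perturbedMass γ z x := by
  unfold perturbedMass
  gcongr
  have : -1 ≤ sgn ((pairing k).symm x).1 * sgn (z ((pairing k).symm x).2) := by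
    refine neg_le_of_abs_le ?_
    rw [abs_mul, abs_sgn, abs_sgn, one_mul]
  nlinarith

/-- The perturbation of the uniform distribution on `[2k]` by the signs `z`. -/
def perturbed (hk : 0 < k) {γ : ℝ} (h0 : 0 ≤ γ) (h1 : γ ≤ 1) (z : Fin k → Bool) :
    ProbDist (Fin (2 * k)) :=
  ⟨perturbedMass γ z, fun x => (le_perturbedMass h0 z x).trans' (by
      have := sub_nonneg.2 h1
      positivity), by
    have hk' : (k : ℝ) ≠ 0 := by positivity
    have : ∀ i : Fin k, (1 + γ * (sgn true * sgn (z i))) / (2 * k) +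
        (1 + γ * (sgn false * sgn (z i))) / (2 * k) = 1 / (k : ℝ) := fun i => by
      simp only [sgn_true, sgn_false]
      field_simp
      ring
    rw [sum_pairing]
    simp only [perturbedMass_pairing, this]
    simp [hk']⟩

variable (hk : 0 < k) {γ : ℝ} (h0 : 0 ≤ γ) (h1 : γ ≤ 1) {Y : Type*} [Fintype Y]

theorem perturbed_sub_perturbed (z : Fin k → Bool) (i : Fin k) :
    (perturbed hk h0 h1 z).1 (pairing k (true, i)) -
      (perturbed hk h0 h1 z).1 (pairing k (false, i)) = γ / k * sgn (z i) := by
  have hk' : (k : ℝ) ≠ 0 := by positivity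
  simp only [perturbed, perturbedMass_pairing, sgn_true, sgn_false]
  field_simp
  ring

theorem msgLaw_sub_msgLaw_flipBit (W : Channel (2 * k) Y) (z : Fin k → Bool) (i : Fin k) (a : Y) :
    msgLaw W (perturbed hk h0 h1 z) a - msgLaw W (perturbed hk h0 h1 (flipBit i z)) a =
      γ / k * sgn (z i) * ((W (pairing k (true, i))).1 a - (W (pairing k (false, i))).1 a) := by
  have hk' : (k : ℝ) ≠ 0 := by positivity
  unfold msgLaw
  rw [sum_pairing, sum_pairing, ← Finset.sum_sub_distrib, Finset.sum_eq_single i]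
  · simp only [perturbed, perturbedMass_pairing, flipBit_same, sgn_not, sgn_true, sgn_false]
    field_simp
    ring
  · intro j _ hj
    simp only [perturbed, perturbedMass_pairing, flipBit_of_ne hj, sub_self]
  · simp

/-- This bounds the chi-square denominators from below; for `γ < 1` it also shows that all message
laws through `W` vanish wherever a perturbed one does. -/
theorem le_msgLaw_perturbed (W : Channel (2 * k) Y) (z : Fin k → Bool) (a : Y) :
    (1 - γ) / (2 * k) * ∑ x, (W x).1 a ≤ msgLaw W (perturbed hk h0 h1 z) a := by
  unfold msgLaw
  rw [Finset.mul_sum]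
  exact Finset.sum_le_sum fun x _ =>
    mul_le_mul_of_nonneg_right (le_perturbedMass h0 z x) ((W x).2.1 a)

theorem apply_eq_zero_of_msgLaw_perturbed (h1' : γ < 1) {W : Channel (2 * k) Y} {z : Fin k → Bool}
    {a : Y} (h : msgLaw W (perturbed hk h0 h1 z) a = 0) (x : Fin (2 * k)) : (W x).1 a = 0 := by
  have h2 := le_msgLaw_perturbed hk h0 h1 W z a
  rw [h] at h2
  have h3 : 0 < (1 - γ) / (2 * k) := by
    have := sub_pos.2 h1'
    positivity
  have h4 : ∑ x, (W x).1 a ≤ 0 := by nlinarith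
  have h5 := (Finset.sum_eq_zero_iff_of_nonneg fun x _ => (W x).2.1 a).1
    (h4.antisymm (Finset.sum_nonneg fun x _ => (W x).2.1 a))
  exact h5 x (Finset.mem_univ x)

theorem msgLaw_eq_zero_of_msgLaw_perturbed (h1' : γ < 1) {W : Channel (2 * k) Y}
    {z : Fin k → Bool} {a : Y} (h : msgLaw W (perturbed hk h0 h1 z) a = 0)
    (p : ProbDist (Fin (2 * k))) : msgLaw W p a = 0 :=
  Finset.sum_eq_zero fun x _ => by
    rw [apply_eq_zero_of_msgLaw_perturbed hk h0 h1 h1' h, mul_zero]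

/-- The information on the signs `z` carried by one message. -/
theorem sum_finKL_msgLaw_le (h1' : γ < 1) (W : Channel (2 * k) Y) (z : Fin k → Bool) :
    ∑ i, finKL (msgLaw W (perturbed hk h0 h1 z)) (msgLaw W (perturbed hk h0 h1 (flipBit i z))) ≤
      2 * γ ^ 2 / (k * (1 - γ)) * Fintype.card Y := by
  have hk' : (0 : ℝ) < k := by positivity
  have hγ : 0 < 1 - γ := sub_pos.2 h1'
  have hchi : ∀ i, finKL (msgLaw W (perturbed hk h0 h1 z))
      (msgLaw W (perturbed hk h0 h1 (flipBit i z))) ≤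
        ∑ a, (γ / k * sgn (z i) *
          ((W (pairing k (true, i))).1 a - (W (pairing k (false, i))).1 a)) ^ 2 /
            msgLaw W (perturbed hk h0 h1 (flipBit i z)) a := fun i => by
    refine (finKL_le_chiSq (msgLaw_nonneg _ _) (msgLaw_nonneg _ _) (sum_msgLaw _ _)
      (sum_msgLaw _ _) fun a h => msgLaw_eq_zero_of_msgLaw_perturbed hk h0 h1 h1' h _).trans_eq ?_
    simp only [msgLaw_sub_msgLaw_flipBit]
  refine (Finset.sum_le_sum fun i _ => hchi i).trans ?_
  rw [Finset.sum_comm]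
  have hmsg : ∀ a, ∑ i, (γ / k * sgn (z i) *
      ((W (pairing k (true, i))).1 a - (W (pairing k (false, i))).1 a)) ^ 2 /
        msgLaw W (perturbed hk h0 h1 (flipBit i z)) a ≤ 2 * γ ^ 2 / (k * (1 - γ)) := fun a => by
    set T := ∑ x, (W x).1 a with hT
    have hT0 : 0 ≤ T := Finset.sum_nonneg fun x _ => (W x).2.1 a
    rcases hT0.eq_or_lt with hT0 | hT0
    · have hW : ∀ x, (W x).1 a = 0 := fun x =>
        (Finset.sum_eq_zero_iff_of_nonneg fun x _ => (W x).2.1 a).1 hT0.symm x (Finset.mem_univ x)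
      simp only [hW]
      simp only [sub_self, mul_zero, ne_eq, OfNat.ofNat_ne_zero, not_false_eq_true, zero_pow,
        zero_div, Finset.sum_const_zero]
      positivity
    -- For `u, v ∈ [0, 1]`, `(u - v)² ≤ u + v`. Summed over the pairs, the right side gives exactly
    -- `T`, which cancels the `T` in the denominator: each symbol contributes a bound independent of
    -- `W`.
    · have hi : ∀ i, (γ / k * sgn (z i) *
          ((W (pairing k (true, i))).1 a - (W (pairing k (false, i))).1 a)) ^ 2 /
            msgLaw W (perturbed hk h0 h1 (flipBit i z)) a ≤
          (γ / k) ^ 2 / ((1 - γ) / (2 * k) * T) *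
            ((W (pairing k (true, i))).1 a + (W (pairing k (false, i))).1 a) := fun i => by
        have hw : ∀ x, (W x).1 a ≤ 1 := fun x => by
          rw [← (W x).2.2]
          exact Finset.single_le_sum (fun b _ => (W x).2.1 b) (Finset.mem_univ a)
        have hu := hw (pairing k (true, i))
        have hv := hw (pairing k (false, i))
        have hu0 := (W (pairing k (true, i))).2.1 a
        have hv0 := (W (pairing k (false, i))).2.1 a
        rw [div_mul_eq_mul_div ((γ / k) ^ 2)]
        refine div_le_div₀ (by positivity) ?_ (by positivity)
          (le_msgLaw_perturbed hk h0 h1 W (flipBit i z) a)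
        rw [mul_pow, mul_pow, sgn_sq, mul_one]
        refine mul_le_mul_of_nonneg_left ?_ (by positivity)
        nlinarith
      refine (Finset.sum_le_sum fun i _ => hi i).trans_eq ?_
      rw [← Finset.mul_sum, ← sum_pairing fun x => (W x).1 a, ← hT]
      field_simp
  refine (Finset.sum_le_sum fun a _ => hmsg a).trans_eq ?_
  rw [Finset.sum_const, Finset.card_univ, nsmul_eq_mul, mul_comm]

end Perturbation

/-! ### From distribution estimates to sign estimates, and the lower bound -/

variable {k : ℕ} {Y : Type*} [Fintype Y]

/-- Truncation to the interval `[-g, g]`. -/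
def clip (g d : ℝ) : ℝ := max (-g) (min g d)

theorem abs_clip_sub_le {g : ℝ} (hg : 0 ≤ g) (d : ℝ) (b : Bool) :
    |clip g d - g * sgn b| ≤ |d - g * sgn b| ∧ |clip g d - g * sgn b| ≤ 2 * g := by
  have h : -g ≤ clip g d ∧ clip g d ≤ g :=
    ⟨le_max_left _ _, max_le (by linarith) (min_le_left _ _)⟩
  have h' : d ≤ clip g d ∨ clip g d = g := by
    rcases le_total g d with hd | hd
    · right; simp only [clip, min_eq_left hd]; exact max_eq_right (by linarith)
    · left; simp only [clip, min_eq_right hd]; exact le_max_right _ _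
  have h'' : clip g d ≤ d ∨ clip g d = -g := by
    rcases le_total (-g) d with hd | hd
    · left; exact max_le hd (min_le_right _ _)
    · right; exact max_eq_left ((min_le_right _ _).trans hd)
  cases b
  · simp only [sgn_false]
    rw [abs_of_nonneg (by linarith : 0 ≤ clip g d - g * -1)]
    refine ⟨?_, by linarith⟩
    rcases h'' with h'' | h''
    · exact (le_abs_self _).trans' (by linarith)
    · exact (abs_nonneg _).trans' (by linarith)
  · simp only [sgn_true]
    rw [abs_of_nonpos (by linarith : clip g d - g * 1 ≤ 0)]
    refine ⟨?_, by linarith⟩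
    rcases h' with h' | h'
    · exact (neg_le_abs _).trans' (by linarith)
    · exact (abs_nonneg _).trans' (by linarith)

/-- The estimate of the scaled signs that is derived from an estimate of the distribution. -/
def signEstimate (g : ℝ) (q : ProbDist (Fin (2 * k))) (i : Fin k) : ℝ :=
  clip g (q.1 (pairing k (true, i)) - q.1 (pairing k (false, i)))

variable (hk : 0 < k) {γ : ℝ} (h0 : 0 ≤ γ) (h1 : γ ≤ 1)

/-- Clipping never increases the distance to `±γ/k`, and it caps the total error at `2γ`. The cap
scales with `ε`, so failures of probability `1/100` stay negligible against the target error. -/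
theorem sum_abs_signEstimate_sub_le (q : ProbDist (Fin (2 * k))) (z : Fin k → Bool) :
    ∑ i, |signEstimate (γ / k) q i - γ / k * sgn (z i)| ≤ 2 * tv q (perturbed hk h0 h1 z) ∧
      ∑ i, |signEstimate (γ / k) q i - γ / k * sgn (z i)| ≤ 2 * γ := by
  have hg : 0 ≤ γ / k := by positivity
  constructor
  · have htv := half_sum_abs_le_tv q (perturbed hk h0 h1 z)
    rw [sum_pairing] at htv
    refine le_trans (Finset.sum_le_sum fun i _ => ?_) (by linarith : _ ≤ _)
    refine (abs_clip_sub_le hg _ (z i)).1.trans ?_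
    rw [← perturbed_sub_perturbed hk h0 h1, sub_sub_sub_comm]
    exact abs_sub _ _
  · refine (Finset.sum_le_sum fun i _ => (abs_clip_sub_le hg _ (z i)).2).trans_eq ?_
    have hk' : (k : ℝ) ≠ 0 := by positivity
    rw [Finset.sum_const, Finset.card_univ, Fintype.card_fin, nsmul_eq_mul]
    field_simp

variable {𝒲 : Set (Channel (2 * k) Y)} {n : ℕ} {Ω : Type u} [MeasurableSpace Ω]

theorem Protocol.sum_transcriptProb_mul_le (P : Protocol 𝒲 n Ω)
    (est : (Fin n → Y) → Ω → ProbDist (Fin (2 * k))) {ε : ℝ} (hε : 0 ≤ ε) (ω : Ω)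
    (z : Fin k → Bool) :
    ∑ y, P.transcriptProb (perturbed hk h0 h1 z) ω y *
        ∑ i, |signEstimate (γ / k) (est y ω) i - γ / k * sgn (z i)| ≤
      2 * ε + 2 * γ * P.failureAt est ε (perturbed hk h0 h1 z) ω := by
  have hε1 : 2 * ε = ∑ y, P.transcriptProb (perturbed hk h0 h1 z) ω y * (2 * ε) := by
    rw [← Finset.sum_mul, P.sum_transcriptProb, one_mul]
  rw [hε1, Protocol.failureAt, Finset.mul_sum, ← Finset.sum_add_distrib]
  refine Finset.sum_le_sum fun y _ => ?_
  have hP := P.transcriptProb_nonneg (perturbed hk h0 h1 z) ω y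
  obtain ⟨h2, h3⟩ := sum_abs_signEstimate_sub_le hk h0 h1 (est y ω) z
  split_ifs with h
  · nlinarith [mul_le_mul_of_nonneg_left h3 hP, mul_nonneg hP hε]
  · nlinarith [mul_le_mul_of_nonneg_left h2 hP, mul_le_mul_of_nonneg_left (not_lt.1 h) hP]

/-- The information on the signs `z` carried by the transcript. -/
theorem Protocol.sum_finKL_transcriptProb_le (h1' : γ < 1) (P : Protocol 𝒲 n Ω) (ω : Ω)
    (z : Fin k → Bool) :
    ∑ i, finKL (P.transcriptProb (perturbed hk h0 h1 z) ω)
        (P.transcriptProb (perturbed hk h0 h1 (flipBit i z)) ω) ≤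
      n * (2 * γ ^ 2 / (k * (1 - γ)) * Fintype.card Y) := by
  have h : ∀ p, P.transcriptProb p ω = seqProb (fun t h => msgLaw (P.channel t h ω) p) := fun p =>
    funext fun y => P.transcriptProb_eq_seqProb p ω y
  simp only [h]
  exact sum_finKL_seqProb_le
    (q' := fun i t h => msgLaw (P.channel t h ω) (perturbed hk h0 h1 (flipBit i z)))
    (fun t h a => msgLaw_nonneg _ _ _) (fun t h => sum_msgLaw _ _)
    (fun i t h a h2 => msgLaw_eq_zero_of_msgLaw_perturbed hk h0 h1 h1' h2 _)
    (fun t h => sum_finKL_msgLaw_le hk h0 h1 h1' _ z)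

theorem Protocol.le_sum_one_sub_tv (h1' : γ < 1) (P : Protocol 𝒲 n Ω) (ω : Ω)
    (z : Fin k → Bool) :
    17 / 20 * k - 5 / 3 * (n * (2 * γ ^ 2 / (k * (1 - γ)) * Fintype.card Y)) ≤
      ∑ i, (1 - (∑ y, |P.transcriptProb (perturbed hk h0 h1 z) ω y -
        P.transcriptProb (perturbed hk h0 h1 (flipBit i z)) ω y|) / 2) := by
  have hac : ∀ i y, P.transcriptProb (perturbed hk h0 h1 (flipBit i z)) ω y = 0 →
      P.transcriptProb (perturbed hk h0 h1 z) ω y = 0 := fun i y => by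
    rw [P.transcriptProb_eq_seqProb, P.transcriptProb_eq_seqProb]
    exact seqProb_eq_zero
      (fun t h a h2 => msgLaw_eq_zero_of_msgLaw_perturbed hk h0 h1 h1' h2 _) y
  have hi : ∀ i, 17 / 20 - 5 / 3 * finKL (P.transcriptProb (perturbed hk h0 h1 z) ω)
      (P.transcriptProb (perturbed hk h0 h1 (flipBit i z)) ω) ≤
        1 - (∑ y, |P.transcriptProb (perturbed hk h0 h1 z) ω y -
          P.transcriptProb (perturbed hk h0 h1 (flipBit i z)) ω y|) / 2 := fun i => by
    have h := sq_sum_abs_sub_le_finKL (P.transcriptProb_nonneg (perturbed hk h0 h1 z) ω)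
      (P.transcriptProb_nonneg (perturbed hk h0 h1 (flipBit i z)) ω) (P.sum_transcriptProb _ ω)
      (P.sum_transcriptProb _ ω) (hac i)
    -- With `t` the total variation distance, `t ≤ 5/3 * t² + 3/20` is the tangent bound at `t =
    -- 3/10`.
    nlinarith [sq_nonneg ((∑ y, |P.transcriptProb (perturbed hk h0 h1 z) ω y -
          P.transcriptProb (perturbed hk h0 h1 (flipBit i z)) ω y|) / 2 - 3 / 10)]
  refine le_trans ?_ (Finset.sum_le_sum fun i _ => hi i)
  rw [Finset.sum_sub_distrib, ← Finset.mul_sum, Finset.sum_const, Finset.card_univ,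
    Fintype.card_fin, nsmul_eq_mul]
  linarith [P.sum_finKL_transcriptProb_le hk h0 h1 h1' ω z]

/-- The lower bound for channels with an arbitrary finite message alphabet. -/
theorem HasEstimator.sq_le {ε : ℝ} (hk : 0 < k) (hε : 0 < ε) (hε' : ε ≤ 1 / 4)
    (h : HasEstimator.{u} 𝒲 n ε) : (k : ℝ) ^ 2 ≤ 1000 * (n * (ε ^ 2 * Fintype.card Y)) := by
  obtain ⟨Ω, _, μ, _, P, est, hest, hfail⟩ := h
  -- The choice `γ = 3ε` keeps `1 - γ ≥ 1/4`, while the Assouad bound, about `17/20 * γ = 2.55ε`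
  -- without information, exceeds the achievable error `2ε + 2γ/100 = 2.06ε`.
  have h0 : 0 ≤ 3 * ε := by linarith
  have h1 : 3 * ε ≤ 1 := by linarith
  have h1' : 3 * ε < 1 := by linarith
  obtain ⟨ω, hω⟩ := P.exists_sum_failureAt_le μ hest (perturbed hk h0 h1) fun z => hfail _
  have hk' : (0 : ℝ) < k := by positivity
  set N : ℝ := (Fintype.card (Fin k → Bool) : ℝ) with hN
  have hN0 : 0 < N := by
    rw [hN]; exact_mod_cast Fintype.card_pos
  set I : ℝ := n * (2 * (3 * ε) ^ 2 / (k * (1 - 3 * ε)) * Fintype.card Y) with hI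
  have hupper := Finset.sum_le_sum fun z (_ : z ∈ Finset.univ) =>
    P.sum_transcriptProb_mul_le hk h0 h1 est hε.le ω z
  rw [Finset.sum_add_distrib, Finset.sum_const, Finset.card_univ, nsmul_eq_mul, ← hN,
    ← Finset.mul_sum _ _ (2 * (3 * ε))] at hupper
  have hlower := assouad (fun z => P.transcriptProb (perturbed hk h0 h1 z) ω)
    (fun z => P.transcriptProb_nonneg _ ω) (fun z => P.sum_transcriptProb _ ω)
    (fun y => signEstimate (3 * ε / k) (est y ω)) (g := 3 * ε / k) (by positivity)
  have hinfo := Finset.sum_le_sum fun z (_ : z ∈ Finset.univ) =>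
    P.le_sum_one_sub_tv hk h0 h1 h1' ω z
  rw [Finset.sum_const, Finset.card_univ, nsmul_eq_mul, ← hN, ← hI] at hinfo
  have hmain : 3 * ε / k * (N * (17 / 20 * k - 5 / 3 * I)) ≤
      N * (2 * ε) + 2 * (3 * ε) * (N * (1 / 100)) :=
    ((mul_le_mul_of_nonneg_left hinfo (by positivity)).trans hlower).trans
      (hupper.trans (by gcongr))
  have hmain' : (N * ε) * (3 * (17 / 20 * k - 5 / 3 * I)) ≤ (N * ε) * (206 / 100 * k) := by
    have := mul_le_mul_of_nonneg_right hmain hk'.le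
    have h2 : 3 * ε / k * (N * (17 / 20 * k - 5 / 3 * I)) * k =
        (N * ε) * (3 * (17 / 20 * k - 5 / 3 * I)) := by field_simp
    linarith
  -- The gap `2.55k - 2.06k ≤ 5I` gives `I ≥ 0.098k`, rounded down.
  have hkI : 9 / 100 * (k : ℝ) ≤ I := by
    have := le_of_mul_le_mul_left hmain' (by positivity)
    linarith
  have hI' : I * k ≤ 72 * (n * (ε ^ 2 * Fintype.card Y)) := by
    have h3 : 1 / 4 ≤ 1 - 3 * ε := by linarith
    have h4 : 0 < 1 - 3 * ε := by linarith
    have h5 : I * k = (18 * (n * (ε ^ 2 * Fintype.card Y))) / (1 - 3 * ε) := by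
      rw [hI]; field_simp; ring
    rw [h5, div_le_iff₀ h4]
    have : 0 ≤ n * (ε ^ 2 * Fintype.card Y) := by positivity
    nlinarith
  nlinarith

end

end DistLearn

theorem mainTheorem9 :
    ∃ c : ℝ, 0 < c ∧ ∀ (k ℓ : ℕ) (ε : ℝ), 1 ≤ ℓ → (ℓ : ℝ) ≤ Real.logb 2 (k : ℝ) →
      0 < ε → ε ≤ 1 / 4 →
      ENNReal.ofReal (c * ((k : ℝ) ^ 2 / (ε ^ 2 * 2 ^ ℓ))) ≤
        ((DistLearn.sampleComplexity.{u} (DistLearn.commChannels (2 * k) ℓ) ε : ℕ∞) : ℝ≥0∞) := by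
  refine ⟨1 / 1000, by norm_num, fun k ℓ ε _ _ hε hε' => ?_⟩
  -- For `k = 0` the claimed bound is `0`.
  rcases Nat.eq_zero_or_pos k with rfl | hk
  · simp
  set x : ℝ := 1 / 1000 * ((k : ℝ) ^ 2 / (ε ^ 2 * 2 ^ ℓ)) with hx
  have hle : ((⌈x⌉₊ : ℕ) : ℕ∞) ≤
      DistLearn.sampleComplexity.{u} (DistLearn.commChannels (2 * k) ℓ) ε := by
    refine le_iInf₂ fun n hn => Nat.cast_le.2 (Nat.ceil_le.2 ?_)
    have h := hn.sq_le hk hε hε'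
    rw [Fintype.card_fun, Fintype.card_bool, Fintype.card_fin] at h
    push_cast at h
    rw [hx, ← mul_div_assoc, div_le_iff₀ (by positivity)]
    linarith
  calc ENNReal.ofReal x ≤ ENNReal.ofReal (⌈x⌉₊ : ℝ) := ENNReal.ofReal_le_ofReal (Nat.le_ceil x)
    _ = (((⌈x⌉₊ : ℕ) : ℕ∞) : ℝ≥0∞) := by simp
    _ ≤ _ := ENat.toENNReal_le.2 hle
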